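/- Let $(\mathcal M,g,A)$ be a Kähler manifold of real dimension $n\ge 4$: $g$ is a smooth Riemannian metric and $A$ a smooth $(1,1)$ tensor field with $A^2=-I$, $g(AX,AY)=g(X,Y)$ and $\nabla A=0$, where $\nabla$ is the Levi-Civita connection of $g$. Let $\pi$ be any smooth 1-form and let $$\overset{1}{\nabla}_XY=\nabla_XY-\pi(X)AY,\qquad \overset{2}{\nabla}_XY=\overset{1}{\nabla}_YX+[X,Y],\qquad \overset{0}{\nabla}=\tfrac12\big(\overset{1}{\nabla}+\overset{2}{\nabla}\big)$$ be the quarter-symmetric metric $A$-connection with generator $\pi$ and the two connections derived from it. Let $R^0,R^1,R^2$ be the curvature tensors of $\overset0\nabla,\overset1\nabla,\overset2\nabla$ (with the convention $R(X,Y)Z=\nabla_X\nabla_YZ-\nabla_Y\nabla_XZ-\nabla_{[X,Y]}Z$) and $$\begin{aligned} R^3(X,Y)Z&=\overset2\nabla_X\overset1\nabla_YZ-\overset1\nabla_Y\overset2\nabla_XZ+\overset2\nabla_{\overset1\nabla_YX}Z-\overset1\nabla_{\overset2\nabla_XY}Z,\\ R^4(X,Y)Z&=\overset2\nabla_X\overset1\nabla_YZ-\overset1\nabla_Y\overset2\nabla_XZ+\overset2\nabla_{\overset2\nabla_YX}Z-\overset1\nabla_{\overset1\nabla_XY}Z,\\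 R^5(X,Y)Z&=\tfrac12\big(\overset1\nabla_X\overset1\nabla_YZ-\overset2\nabla_Y\overset1\nabla_XZ+\overset2\nabla_X\overset2\nabla_YZ-\overset1\nabla_Y\overset2\nabla_XZ-\overset1\nabla_{[X,Y]}Z-\overset2\nabla_{[X,Y]}Z\big). \end{aligned}$$ Put $\mathrm{Ric}^\theta(Y,Z)=\mathrm{Trace}\{X\mapsto R^\theta(X,Y)Z\}$ and ${}'\!R^\theta(X,Y)=\mathrm{Trace}\{Z\mapsto R^\theta(X,Y)Z\}$; let $R$ be the curvature tensor of $\nabla$ and $\mathrm{Ric}(Y,Z)=\mathrm{Trace}\{X\mapsto R(X,Y)Z\}$. Define $$\begin{aligned} H^0(X,Y)Z={}&R^0(X,Y)Z+\tfrac1{n-1}\big(\mathrm{Ric}^0(X,Z)Y-\mathrm{Ric}^0(Y,Z)X\big)-\tfrac1{2(n-1)}\big(\mathrm{Ric}^1(X,Z)Y-\mathrm{Ric}^1(Y,Z)X\big)\\ &-\tfrac1{4(n-1)}\big(\mathrm{Ric}^3(Z,X)Y-\mathrm{Ric}^3(Z,Y)X+{}'\!R^3(AZ,AX)Y-{}'\!R^3(AZ,AY)X\big)\\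 &+\tfrac14\big(2\mathrm{Ric}^1(Y,AX)AZ+\mathrm{Ric}^3(Z,AX)AY-\mathrm{Ric}^3(Z,AY)AX\big)-\tfrac14\big({}'\!R^3(AZ,X)AY-{}'\!R^3(AZ,Y)AX\big),\\ H^1(X,Y)Z={}&R^1(X,Y)Z+\mathrm{Ric}^1(Y,AX)AZ,\\ H^2(X,Y)Z={}&R^2(X,Y)Z+\mathrm{Ric}^2(AX,Z)AY-\mathrm{Ric}^2(AY,Z)AX,\\ H^4(X,Y)Z={}&R^4(X,Y)Z-{}'\!R^4(AY,X)AZ+{}'\!R^4(AZ,Y)AX\\ &-\tfrac1{n-1}\big(\mathrm{Ric}^4(Y,Z)X-\mathrm{Ric}^4(X,Z)Y-{}'\!R^4(AY,AZ)X+{}'\!R^4(AX,AZ)Y\big),\\ H^5(X,Y)Z={}&R^5(X,Y)Z+\tfrac1{n-1}\big(\mathrm{Ric}^5(X,Y)Z-\mathrm{Ric}^5(Y,Z)X\big)-\tfrac1{2(n-1)}\big(\mathrm{Ric}^1(X,Y)Z-\mathrm{Ric}^1(Y,Z)X\big)\\ &-\tfrac1{2(n-1)}\big({}'\!R^3(AY,AX)Z-{}'\!R^3(AZ,AY)X\big)\\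 &+\tfrac12\big(\mathrm{Ric}^1(Y,AX)AZ-\mathrm{Ric}^3(Z,AY)AX-{}'\!R^3(AZ,X)AY\big), \end{aligned}$$ and let $P$ be the holomorphically projective curvature tensor of the Kähler metric, $$P(X,Y)Z=R(X,Y)Z+\tfrac1{n+2}\big(\mathrm{Ric}(X,Z)Y-\mathrm{Ric}(Y,Z)X\big)-\tfrac1{n+2}\big(\mathrm{Ric}(X,AZ)AY-\mathrm{Ric}(Y,AZ)AX+2\,\mathrm{Ric}(X,AY)AZ\big).$$ Then for all smooth vector fields $X,Y,Z$: $$\begin{aligned} P(X,Y)Z&=\tfrac{4}{n+2}H^0(X,Y)Z+\tfrac{n-2}{n+2}H^4(X,Y)Z,\\ P(X,Y)Z&=\tfrac{4(n-1)}{n+2}H^0(X,Y)Z-\tfrac{2(n-2)}{n+2}H^1(X,Y)Z-\tfrac{n-2}{n+2}H^2(X,Y)Z,\\ P(X,Y)Z&=\tfrac{4}{n+2}H^0(X,Y)Z+\tfrac{n-2}{n+2}\big(2H^5(X,Z)Y-H^1(X,Z)Y+H^1(Z,Y)X\big). \end{aligned}$$ -/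

import Mathlib

open Bundle Module
open scoped Manifold ContDiff

noncomputable section

namespace QuarterSymmetric

variable {E : Type*} [NormedAddCommGroup E] [NormedSpace ℝ E] [FiniteDimensional ℝ E]
  {H : Type*} [TopologicalSpace H] {I : ModelWithCorners ℝ E H}
  {M : Type*} [TopologicalSpace M] [ChartedSpace H M]

/-- A (not necessarily smooth) vector field on `M`. -/
abbrev VField (I : ModelWithCorners ℝ E H) (M : Type*) [TopologicalSpace M] [ChartedSpace H M] :=
  Π x : M, TangentSpace I x

/-- A linear connection on `M`: a covariant derivative on the tangent bundle. -/
abbrev Connection (I : ModelWithCorners ℝ E H) (M : Type*) [TopologicalSpace M] [ChartedSpace H M]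
    [IsManifold I ∞ M] :=
  CovariantDerivative I E (TangentSpace I : M → Type _)

/-- A field of endomorphisms of the tangent spaces, i.e. a tensor field of type `(1,1)`. -/
abbrev EndField (I : ModelWithCorners ℝ E H) (M : Type*) [TopologicalSpace M] [ChartedSpace H M] :=
  Π x : M, TangentSpace I x →L[ℝ] TangentSpace I x

/-- A field of linear forms on the tangent spaces, i.e. a 1-form. -/
abbrev FormField (I : ModelWithCorners ℝ E H) (M : Type*) [TopologicalSpace M] [ChartedSpace H M] :=
  Π x : M, TangentSpace I x →L[ℝ] ℝ

/-- The vector field `A X`. -/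
def act (A : EndField I M) (X : VField I M) : VField I M := fun x ↦ A x (X x)

/-- `A` is a smooth tensor field. -/
def IsSmoothEnd (A : EndField I M) [IsManifold I ∞ M] : Prop :=
  ContMDiff I (I.prod 𝓘(ℝ, E →L[ℝ] E)) ∞
    (fun x ↦ TotalSpace.mk' (E →L[ℝ] E) (E := fun x : M ↦ TangentSpace I x →L[ℝ] TangentSpace I x)
      x (A x))

/-- `η` is a smooth 1-form. -/
def IsSmoothForm (η : FormField I M) [IsManifold I ∞ M] : Prop :=
  ContMDiff I (I.prod 𝓘(ℝ, E →L[ℝ] ℝ)) ∞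
    (fun x ↦ TotalSpace.mk' (E →L[ℝ] ℝ) (E := fun x : M ↦ TangentSpace I x →L[ℝ] ℝ) x (η x))

variable [IsManifold I ∞ M]

/-- The vector field `∇_X Y`. -/
def along (D : Connection I M) (X Y : VField I M) : VField I M := fun x ↦ D Y x (X x)

/-! ### The connections attached to a non-symmetric connection -/

/-- The connection `∇²_X Y = ∇¹_Y X + [X, Y]` of a connection `∇¹`, written as
`∇²_X Y = ∇¹_X Y + T(Y, X)` with `T` the torsion of `∇¹`. -/
def opposite (D : Connection I M) : Connection I M :=
  D.addOneForm fun x ↦ D.torsion x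

/-- The symmetric connection `∇⁰ = (∇¹ + ∇²) / 2` of a connection `∇¹`. -/
def symmetrized (D : Connection I M) : Connection I M :=
  D.addOneForm fun x ↦ (1 / 2 : ℝ) • D.torsion x

theorem along_opposite (D : Connection I M) {X Y : VField I M} {x : M}
    (hX : MDiffAt (T% X) x) (hY : MDiffAt (T% Y) x) :
    along (opposite D) X Y x = along D Y X x + VectorField.mlieBracket I X Y x := by
  have h := D.torsion_apply hX hY
  rw [D.torsion_antisymm] at h
  change D Y x (X x) + D.torsion x (Y x) (X x) = D X x (Y x) + _
  rw [neg_eq_iff_eq_neg.mp h]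
  abel

theorem along_symmetrized (D : Connection I M) (X Y : VField I M) (x : M) :
    along (symmetrized D) X Y x
      = (1 / 2 : ℝ) • (along D X Y x + along (opposite D) X Y x) := by
  change D Y x (X x) + (1 / 2 : ℝ) • D.torsion x (Y x) (X x)
    = (1 / 2 : ℝ) • (D Y x (X x) + (D Y x (X x) + D.torsion x (Y x) (X x)))
  module

/-! ### The six curvature tensors of a non-symmetric connection

Throughout, `D = ∇¹` is the given connection and `opposite D = ∇²`. -/

/-- `R¹(X,Y)Z = ∇¹_X ∇¹_Y Z - ∇¹_Y ∇¹_X Z - ∇¹_[X,Y] Z`, the curvature of `∇¹`. -/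
def curv1 (D : Connection I M) (X Y Z : VField I M) : VField I M :=
  along D X (along D Y Z) - along D Y (along D X Z)
    - along D (VectorField.mlieBracket I X Y) Z

/-- `R⁰`, the curvature of the symmetric connection `∇⁰`. -/
def curv0 (D : Connection I M) (X Y Z : VField I M) : VField I M :=
  curv1 (symmetrized D) X Y Z

/-- `R²`, the curvature of `∇²`. -/
def curv2 (D : Connection I M) (X Y Z : VField I M) : VField I M :=
  curv1 (opposite D) X Y Z

/-- `R³(X,Y)Z = ∇²_X ∇¹_Y Z - ∇¹_Y ∇²_X Z + ∇²_{∇¹_Y X} Z - ∇¹_{∇²_X Y} Z`. -/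
def curv3 (D : Connection I M) (X Y Z : VField I M) : VField I M :=
  along (opposite D) X (along D Y Z) - along D Y (along (opposite D) X Z)
    + along (opposite D) (along D Y X) Z - along D (along (opposite D) X Y) Z

/-- `R⁴(X,Y)Z = ∇²_X ∇¹_Y Z - ∇¹_Y ∇²_X Z + ∇²_{∇²_Y X} Z - ∇¹_{∇¹_X Y} Z`. -/
def curv4 (D : Connection I M) (X Y Z : VField I M) : VField I M :=
  along (opposite D) X (along D Y Z) - along D Y (along (opposite D) X Z)
    + along (opposite D) (along (opposite D) Y X) Z - along D (along D X Y) Z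

/-- `R⁵(X,Y)Z = (∇¹_X ∇¹_Y Z - ∇²_Y ∇¹_X Z + ∇²_X ∇²_Y Z - ∇¹_Y ∇²_X Z
  - ∇¹_[X,Y] Z - ∇²_[X,Y] Z) / 2`. -/
def curv5 (D : Connection I M) (X Y Z : VField I M) : VField I M :=
  (1 / 2 : ℝ) • (along D X (along D Y Z) - along (opposite D) Y (along D X Z)
    + along (opposite D) X (along (opposite D) Y Z) - along D Y (along (opposite D) X Z)
    - along D (VectorField.mlieBracket I X Y) Z
    - along (opposite D) (VectorField.mlieBracket I X Y) Z)

/-! ### Traces -/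

instance instFiniteDimensionalTangentSpace (x : M) : FiniteDimensional ℝ (TangentSpace I x) :=
  inferInstanceAs (FiniteDimensional ℝ E)

/-- The trace at `x` of the endomorphism `v ↦ Φ(V)(x)` of `T_x M`, where `V` is an extension of `v`
to a vector field near `x` and `Φ` is an operation on vector fields that is tensorial. -/
def fieldTrace (Φ : VField I M → VField I M) (x : M) : ℝ :=
  ∑ i, (finBasis ℝ (TangentSpace I x)).repr
    (Φ (FiberBundle.extend E (finBasis ℝ (TangentSpace I x) i)) x) i

theorem fieldTrace_eq_trace (Φ : VField I M → VField I M) (x : M)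
    (f : TangentSpace I x →ₗ[ℝ] TangentSpace I x)
    (hf : ∀ v, f v = Φ (FiberBundle.extend E v) x) :
    fieldTrace Φ x = LinearMap.trace ℝ (TangentSpace I x) f := by
  rw [LinearMap.trace_eq_matrix_trace ℝ (finBasis ℝ (TangentSpace I x))]
  simp [fieldTrace, Matrix.trace, LinearMap.toMatrix_apply, hf]

/-- `Ric(Y,Z) = Trace {X ↦ R(X,Y)Z}`, a function on `M`. -/
def ricci (R : VField I M → VField I M → VField I M → VField I M) (Y Z : VField I M) : M → ℝ :=
  fieldTrace fun X ↦ R X Y Z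

/-- `'R(X,Y) = Trace {Z ↦ R(X,Y)Z}`, a function on `M`. -/
def ricci' (R : VField I M → VField I M → VField I M → VField I M) (X Y : VField I M) : M → ℝ :=
  fieldTrace fun Z ↦ R X Y Z

/-! ### The tensors built from the curvature tensors

`D` is the quarter-symmetric connection and `n` the dimension of `M`. -/

/-- The tensor `H⁰`. -/
def tensorH0 (D : Connection I M) (A : EndField I M) (X Y Z : VField I M) : VField I M :=
  let n : ℝ := finrank ℝ E
  curv0 D X Y Z
    + (1 / (n - 1)) • (ricci (curv0 D) X Z • Y - ricci (curv0 D) Y Z • X)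
    - (1 / (2 * (n - 1))) • (ricci (curv1 D) X Z • Y - ricci (curv1 D) Y Z • X)
    - (1 / (4 * (n - 1))) • (ricci (curv3 D) Z X • Y - ricci (curv3 D) Z Y • X
        + ricci' (curv3 D) (act A Z) (act A X) • Y - ricci' (curv3 D) (act A Z) (act A Y) • X)
    + (1 / 4 : ℝ) • ((2 : ℝ) • ricci (curv1 D) Y (act A X) • act A Z
        + ricci (curv3 D) Z (act A X) • act A Y - ricci (curv3 D) Z (act A Y) • act A X)
    - (1 / 4 : ℝ) • (ricci' (curv3 D) (act A Z) X • act A Y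
        - ricci' (curv3 D) (act A Z) Y • act A X)

/-- The tensor `H¹`. -/
def tensorH1 (D : Connection I M) (A : EndField I M) (X Y Z : VField I M) : VField I M :=
  curv1 D X Y Z + ricci (curv1 D) Y (act A X) • act A Z

/-- The tensor `H²`. -/
def tensorH2 (D : Connection I M) (A : EndField I M) (X Y Z : VField I M) : VField I M :=
  curv2 D X Y Z + ricci (curv2 D) (act A X) Z • act A Y - ricci (curv2 D) (act A Y) Z • act A X

/-- The tensor `H⁴`. -/
def tensorH4 (D : Connection I M) (A : EndField I M) (X Y Z : VField I M) : VField I M :=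
  let n : ℝ := finrank ℝ E
  curv4 D X Y Z - ricci' (curv4 D) (act A Y) X • act A Z + ricci' (curv4 D) (act A Z) Y • act A X
    - (1 / (n - 1)) • (ricci (curv4 D) Y Z • X - ricci (curv4 D) X Z • Y
        - ricci' (curv4 D) (act A Y) (act A Z) • X + ricci' (curv4 D) (act A X) (act A Z) • Y)

/-- The tensor `H⁵`. -/
def tensorH5 (D : Connection I M) (A : EndField I M) (X Y Z : VField I M) : VField I M :=
  let n : ℝ := finrank ℝ E
  curv5 D X Y Z
    + (1 / (n - 1)) • (ricci (curv5 D) X Y • Z - ricci (curv5 D) Y Z • X)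
    - (1 / (2 * (n - 1))) • (ricci (curv1 D) X Y • Z - ricci (curv1 D) Y Z • X)
    - (1 / (2 * (n - 1))) • (ricci' (curv3 D) (act A Y) (act A X) • Z
        - ricci' (curv3 D) (act A Z) (act A Y) • X)
    + (1 / 2 : ℝ) • (ricci (curv1 D) Y (act A X) • act A Z - ricci (curv3 D) Z (act A Y) • act A X
        - ricci' (curv3 D) (act A Z) X • act A Y)

/-- The holomorphically projective curvature tensor, where `D` is the Levi-Civita connection. -/
def holProjCurv (D : Connection I M) (A : EndField I M) (X Y Z : VField I M) : VField I M :=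
  let n : ℝ := finrank ℝ E
  curv1 D X Y Z
    + (1 / (n + 2)) • (ricci (curv1 D) X Z • Y - ricci (curv1 D) Y Z • X)
    - (1 / (n + 2)) • (ricci (curv1 D) X (act A Z) • act A Y - ricci (curv1 D) Y (act A Z) • act A X
        + (2 : ℝ) • ricci (curv1 D) X (act A Y) • act A Z)

/-! ### Kähler manifolds and the quarter-symmetric connection -/

/-- A smooth Riemannian metric on `M`. -/
abbrev Metric (I : ModelWithCorners ℝ E H) (M : Type*) [TopologicalSpace M] [ChartedSpace H M]
    [IsManifold I ∞ M] :=
  ContMDiffRiemannianMetric I ∞ E (fun x : M ↦ TangentSpace I x)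

/-- `D` is the Levi-Civita connection of the Riemannian metric `g`: the smooth linear connection
that is torsion-free and compatible with the metric, `v (g(Y, Z)) = g(∇_v Y, Z) + g(Y, ∇_v Z)`. -/
structure IsLeviCivita (g : Metric I M) (D : Connection I M) : Prop where
  smooth : CovariantDerivative.ContMDiffCovariantDerivative D ∞
  torsion_eq_zero : D.torsion = 0
  metric : ∀ (Y Z : VField I M) (x : M), MDiffAt (T% Y) x → MDiffAt (T% Z) x →
    ∀ v : TangentSpace I x,
      mvfderiv I (fun y ↦ g.inner y (Y y) (Z y)) x v
        = g.inner x (D Y x v) (Z x) + g.inner x (Y x) (D Z x v)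

/-- `A` is a smooth almost complex structure with `g(AX, AY) = g(X, Y)` that is parallel for
the connection `D`. If `D` is the Levi-Civita connection of `g`, this says that `(M, g, A)` is a
Kähler manifold. -/
structure IsKahlerStructure (g : Metric I M) (D : Connection I M) (A : EndField I M) : Prop where
  smooth : IsSmoothEnd A
  sq_eq_neg : ∀ (x : M) (v : TangentSpace I x), A x (A x v) = -v
  inner_eq : ∀ (x : M) (v w : TangentSpace I x), g.inner x (A x v) (A x w) = g.inner x v w
  parallel : ∀ (Y : VField I M) (x : M), MDiffAt (T% Y) x →
    ∀ v : TangentSpace I x, D (act A Y) x v = A x (D Y x v)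

/-- The quarter-symmetric connection `∇¹_X Y = ∇_X Y - η(X) A Y` with generator `η`. -/
def quarterSymmetric (D : Connection I M) (A : EndField I M) (η : FormField I M) :
    Connection I M where
  toFun Y x := D Y x - (η x).smulRight (A x (Y x))
  isCovariantDerivativeOnUniv :=
    { add := by
        intro Y Y' x hY hY' _
        ext v
        simp [D.isCovariantDerivativeOn.add hY hY']
        module
      leibniz := by
        intro Y f x hY hf _
        ext v
        simp [D.isCovariantDerivativeOn.leibniz hY hf]
        module }

end QuarterSymmetric

end

open scoped Topology
open Filter

noncomputable section

namespace QuarterSymmetric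

section Smoothness

variable {E : Type*} [NormedAddCommGroup E] [NormedSpace ℝ E]
  {H : Type*} [TopologicalSpace H] {I : ModelWithCorners ℝ E H}
  {M : Type*} [TopologicalSpace M] [ChartedSpace H M] [IsManifold I ∞ M]
  {X Y : VField I M} {f : M → ℝ} {x : M}

/-- The vector field `X` is smooth in a neighbourhood of `x`. -/
def SmoothNear (X : VField I M) (x : M) : Prop := ∀ᶠ y in 𝓝 x, CMDiffAt ∞ (T% X) y

/-- The function `f` is smooth in a neighbourhood of `x`. -/
def SmoothFunNear (I : ModelWithCorners ℝ E H) (f : M → ℝ) (x : M) : Prop :=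
  ∀ᶠ y in 𝓝 x, CMDiffAt ∞ f y

namespace SmoothNear

theorem contMDiffAt (hX : SmoothNear X x) : CMDiffAt ∞ (T% X) x := hX.self_of_nhds

theorem mdiffAt (hX : SmoothNear X x) : MDiffAt (T% X) x :=
  hX.contMDiffAt.mdifferentiableAt (by simp)

theorem eventually (hX : SmoothNear X x) : ∀ᶠ y in 𝓝 x, SmoothNear X y :=
  eventually_eventually_nhds.2 hX

theorem add (hX : SmoothNear X x) (hY : SmoothNear Y x) : SmoothNear (X + Y) x := by
  filter_upwards [hX, hY] with y hX hY using hX.add_section hY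

theorem sub (hX : SmoothNear X x) (hY : SmoothNear Y x) : SmoothNear (X - Y) x := by
  filter_upwards [hX, hY] with y hX hY using hX.sub_section hY

theorem smul (hf : SmoothFunNear I f x) (hX : SmoothNear X x) : SmoothNear (f • X) x := by
  filter_upwards [hf, hX] with y hf hX using hf.smul_section hX

theorem const_smul (c : ℝ) (hX : SmoothNear X x) : SmoothNear (c • X) x := by
  filter_upwards [hX] with y hX using hX.const_smul_section

theorem extend [FiniteDimensional ℝ E] (v : TangentSpace I x) :
    SmoothNear (FiberBundle.extend E v) x := by
  obtain ⟨s, hs, h⟩ := FiberBundle.exists_contMDiffOn_extend (k := ∞) I E v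
  filter_upwards [eventually_mem_nhds_iff.2 hs] with y hy using h.contMDiffAt hy

theorem act {A : EndField I M} (hA : IsSmoothEnd A) (hX : SmoothNear X x) :
    SmoothNear (act A X) x := by
  filter_upwards [hX] with y hX
  exact ContMDiffAt.clm_bundle_apply (hA y) hX

end SmoothNear

namespace SmoothFunNear

omit [IsManifold I ∞ M] in
theorem mdiffAt (hf : SmoothFunNear I f x) : MDiffAt f x :=
  hf.self_of_nhds.mdifferentiableAt (by simp)

theorem inner (g : Metric I M) (hX : SmoothNear X x) (hY : SmoothNear Y x) :
    SmoothFunNear I (fun y ↦ g.inner y (X y) (Y y)) x := by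
  filter_upwards [hX, hY] with y hX hY
  have := ContMDiffAt.clm_bundle_apply₂ (F₃ := ℝ) (E₃ := Bundle.Trivial M ℝ)
    (ψ := fun y ↦ g.inner y) (g.contMDiff y) hX hY
  exact ((contMDiffAt_section _).1 this)

end SmoothFunNear

theorem mdiffAt_form_apply {η : FormField I M} (hη : IsSmoothForm η) (hX : MDiffAt (T% X) x) :
    MDiffAt (fun y ↦ η y (X y)) x := by
  have := MDifferentiableAt.clm_bundle_apply (F₂ := ℝ) (E₂ := Bundle.Trivial M ℝ)
    (ϕ := fun y ↦ η y) ((hη x).mdifferentiableAt (by simp)) hX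
  exact (mdifferentiableAt_section _ _).1 this

/-- A smooth connection maps vector fields smooth near `x` to sections smooth near `x`. -/
theorem SmoothNear.along [FiniteDimensional ℝ E] [T2Space M] {D : Connection I M}
    (hD : CovariantDerivative.ContMDiffCovariantDerivative D ∞) (hX : SmoothNear X x)
    (hY : SmoothNear Y x) : SmoothNear (along D X Y) x := by
  filter_upwards [hX, hY.eventually] with y hX hY
  obtain ⟨u, hu, hyu⟩ := _root_.eventually_nhds_iff.1 hY
  obtain ⟨ψ, -, hψ⟩ := (SmoothBumpFunction.nhds_basis_tsupport (I := I) y).mem_iff.1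
    (hyu.1.mem_nhds hyu.2)
  have h : ContMDiff I I.tangent ∞ (T% ((ψ : M → ℝ) • Y)) :=
    ContMDiffOn.smul_section_of_tsupport ψ.contMDiff.contMDiffOn hyu.1 hψ
      fun z hz ↦ (hu z hz).contMDiffWithinAt
  have hDY := hD.contMDiff.contMDiff (σ := (ψ : M → ℝ) • Y) (by simpa using h.contMDiffOn)
  have hDY' := ContMDiffAt.clm_bundle_apply (hDY.contMDiffAt univ_mem) hX
  refine hDY'.congr_of_eventuallyEq ?_
  filter_upwards [ψ.eventuallyEq_one.eventuallyEq_nhds, hY.eventually] with z hz hYz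
  have := D.isCovariantDerivativeOnUniv.congr_of_eventuallyEq (σ := Y)
    (σ' := (ψ : M → ℝ) • Y) hYz.mdiffAt ((h z).mdifferentiableAt (by simp)) univ_mem
    (hz.mono fun w hw ↦ by simp [hw])
  simp only [QuarterSymmetric.along]
  rw [this]

end Smoothness

section Curvature

variable {E : Type*} [NormedAddCommGroup E] [NormedSpace ℝ E] [FiniteDimensional ℝ E]
  {H : Type*} [TopologicalSpace H] {I : ModelWithCorners ℝ E H}
  {M : Type*} [TopologicalSpace M] [ChartedSpace H M] [IsManifold I ∞ M]
  {X X' Y Z W : VField I M} {f : M → ℝ} {x : M}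

open VectorField

omit [FiniteDimensional ℝ E] in
theorem isManifold_minSmoothness (k : ℕ) : IsManifold I (minSmoothness ℝ (k : ℕ∞)) M := by
  rw [minSmoothness_of_isRCLikeNormedField]
  exact IsManifold.of_le (n := ∞) (by exact_mod_cast le_top)

theorem SmoothNear.mlieBracket (hX : SmoothNear X x) (hY : SmoothNear Y x) :
    SmoothNear (mlieBracket I X Y) x := by
  have : IsManifold I (minSmoothness ℝ 2) M := isManifold_minSmoothness 2
  have : IsManifold I (((⊤ : ℕ∞) : WithTop ℕ∞) + 1) M := by simpa
  filter_upwards [hX, hY] with y hX hY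
  exact ContMDiffAt.mlieBracket_vectorField (m := ⊤) (n := ⊤) hX hY (by simp)

/-- The Lie bracket of vector fields acts on functions as the commutator of derivations. -/
theorem mvfderiv_commutator [Nontrivial E] (hX : SmoothNear X x) (hY : SmoothNear Y x)
    (hf : SmoothFunNear I f x) (hXf : MDiffAt (fun y ↦ mvfderiv I f y (X y)) x)
    (hYf : MDiffAt (fun y ↦ mvfderiv I f y (Y y)) x) :
    mvfderiv I (fun y ↦ mvfderiv I f y (Y y)) x (X x)
      - mvfderiv I (fun y ↦ mvfderiv I f y (X y)) x (Y x)
      = mvfderiv I f x (mlieBracket I X Y x) := by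
  have : IsManifold I (minSmoothness ℝ 3) M := isManifold_minSmoothness 3
  have h2 : minSmoothness ℝ 2 ≤ ∞ := by
    rw [minSmoothness_of_isRCLikeNormedField]
    exact WithTop.coe_le_coe.2 (le_top : (2 : ℕ∞) ≤ ⊤)
  obtain ⟨v, hv⟩ : ∃ v : TangentSpace I x, v ≠ 0 := exists_ne (α := E) 0
  set W : VField I M := FiberBundle.extend E v
  have hW : SmoothNear W x := SmoothNear.extend v
  have hWx : W x = v := by simp [W]
  have h₁ := leibniz_identity_mlieBracket_apply (hX.contMDiffAt.of_le h2)
    (hY.contMDiffAt.of_le h2) (hW.contMDiffAt.of_le h2)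
  have h₂ := leibniz_identity_mlieBracket_apply (hX.contMDiffAt.of_le h2)
    (hY.contMDiffAt.of_le h2) ((SmoothNear.smul hf hW).contMDiffAt.of_le h2)
  have key {U : VField I M} : mlieBracket I U (f • W)
      =ᶠ[𝓝 x] (fun y ↦ mvfderiv I f y (U y)) • W + f • mlieBracket I U W := by
    filter_upwards [eventually_eventually_nhds.2 hf, hW.eventually] with y hf hW
    exact mlieBracket_smul_right (SmoothFunNear.mdiffAt hf) hW.mdiffAt
  have expand {U V : VField I M} (hV : SmoothNear V x)
      (hVf : MDiffAt (fun y ↦ mvfderiv I f y (V y)) x) :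
      mlieBracket I U (mlieBracket I V (f • W)) x
        = mvfderiv I (fun y ↦ mvfderiv I f y (V y)) x (U x) • v
          + mvfderiv I f x (V x) • mlieBracket I U W x
          + (mvfderiv I f x (U x) • mlieBracket I V W x
            + f x • mlieBracket I U (mlieBracket I V W) x) := by
    rw [EventuallyEq.mlieBracket_vectorField_eq (EventuallyEq.refl (𝓝 x) U) (key (U := V)),
      mlieBracket_add_right (hVf.smul_section hW.mdiffAt)
        (hf.mdiffAt.smul_section (hV.mlieBracket hW).mdiffAt),
      mlieBracket_smul_right hVf hW.mdiffAt,
      mlieBracket_smul_right hf.mdiffAt (hV.mlieBracket hW).mdiffAt, hWx]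
  rw [expand hY hYf, expand hX hXf, mlieBracket_smul_right hf.mdiffAt hW.mdiffAt, h₁, hWx] at h₂
  refine smul_left_injective ℝ hv ?_
  simp only
  rw [sub_smul, sub_eq_iff_eq_add, ← sub_eq_zero]
  rw [← sub_eq_zero] at h₂
  rw [← h₂]
  module

variable {D : Connection I M}

omit [FiniteDimensional ℝ E] in
theorem along_add_right (hY : MDiffAt (T% Y) x) (hZ : MDiffAt (T% Z) x) :
    along D X (Y + Z) x = along D X Y x + along D X Z x := by
  simp [along, D.isCovariantDerivativeOn.add (s := Set.univ) hY hZ]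

omit [FiniteDimensional ℝ E] in
theorem along_const_smul_right (c : ℝ) (hY : MDiffAt (T% Y) x) :
    along D X (c • Y) x = c • along D X Y x := by
  simp [along, D.isCovariantDerivativeOn.smul_const (s := Set.univ) c hY]

omit [FiniteDimensional ℝ E] in
theorem along_smul_right (hf : MDiffAt f x) (hY : MDiffAt (T% Y) x) :
    along D X (f • Y) x = f x • along D X Y x + mvfderiv I f x (X x) • Y x := by
  simp [along, D.isCovariantDerivativeOn.leibniz (s := Set.univ) hY hf]

omit [FiniteDimensional ℝ E] in
theorem along_sub_right (hY : MDiffAt (T% Y) x) (hZ : MDiffAt (T% Z) x) :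
    along D X (Y - Z) x = along D X Y x - along D X Z x := by
  have h : MDiffAt (T% ((-1 : ℝ) • Z)) x :=
    (mdifferentiableAt_const (c := (-1 : ℝ))).smul_section hZ
  rw [show Y - Z = Y + (-1 : ℝ) • Z by simp [sub_eq_add_neg], along_add_right hY h,
    along_const_smul_right _ hZ]
  simp [sub_eq_add_neg]

omit [FiniteDimensional ℝ E] in
theorem along_congr_right (hY : MDiffAt (T% Y) x) (hZ : MDiffAt (T% Z) x) (h : Y =ᶠ[𝓝 x] Z) :
    along D X Y x = along D X Z x := by
  rw [along, along, D.isCovariantDerivativeOnUniv.congr_of_eventuallyEq hY hZ univ_mem h]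

theorem along_sub_along (hT : D.torsion = 0) (hX : MDiffAt (T% X) x) (hY : MDiffAt (T% Y) x) :
    along D X Y x - along D Y X x = mlieBracket I X Y x :=
  D.torsion_eq_zero_iff.1 hT hX hY

omit [FiniteDimensional ℝ E] in
theorem curv1_swap (X Y Z : VField I M) : curv1 D X Y Z = -curv1 D Y X Z := by
  ext y
  simp only [curv1, Pi.sub_apply, Pi.neg_apply, along]
  rw [mlieBracket_swap_apply, map_neg]
  abel

variable [T2Space M]

theorem curv1_add_right (hD : CovariantDerivative.ContMDiffCovariantDerivative D ∞)
    (hX : SmoothNear X x) (hY : SmoothNear Y x) (hZ : SmoothNear Z x) (hW : SmoothNear W x) :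
    curv1 D X Y (Z + W) x = curv1 D X Y Z x + curv1 D X Y W x := by
  have key {U V : VField I M} (hV : SmoothNear V x) :
      along D U (along D V (Z + W)) x = along D U (along D V Z) x + along D U (along D V W) x := by
    rw [← along_add_right (hV.along hD hZ).mdiffAt (hV.along hD hW).mdiffAt]
    refine along_congr_right (hV.along hD (hZ.add hW)).mdiffAt
      ((hV.along hD hZ).add (hV.along hD hW)).mdiffAt ?_
    filter_upwards [hZ.eventually, hW.eventually] with y hZ hW
      using along_add_right hZ.mdiffAt hW.mdiffAt
  simp only [curv1, Pi.sub_apply]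
  rw [key hX, key hY, along_add_right hZ.mdiffAt hW.mdiffAt]
  abel

theorem curv1_const_smul_right (hD : CovariantDerivative.ContMDiffCovariantDerivative D ∞)
    (hX : SmoothNear X x) (hY : SmoothNear Y x) (hZ : SmoothNear Z x) (c : ℝ) :
    curv1 D X Y (c • Z) x = c • curv1 D X Y Z x := by
  have key {U V : VField I M} (hV : SmoothNear V x) :
      along D U (along D V (c • Z)) x = c • along D U (along D V Z) x := by
    rw [← along_const_smul_right c (hV.along hD hZ).mdiffAt]
    refine along_congr_right (hV.along hD (hZ.const_smul c)).mdiffAt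
      ((hV.along hD hZ).const_smul c).mdiffAt ?_
    filter_upwards [hZ.eventually] with y hZ using along_const_smul_right c hZ.mdiffAt
  simp only [curv1, Pi.sub_apply]
  rw [key hX, key hY, along_const_smul_right c hZ.mdiffAt]
  module

/-- The first Bianchi identity. -/
theorem curv1_bianchi (hD : CovariantDerivative.ContMDiffCovariantDerivative D ∞)
    (hT : D.torsion = 0)
    (hX : SmoothNear X x) (hY : SmoothNear Y x) (hZ : SmoothNear Z x) :
    curv1 D X Y Z x + curv1 D Y Z X x + curv1 D Z X Y x = 0 := by
  have : IsManifold I (minSmoothness ℝ 3) M := isManifold_minSmoothness 3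
  have h2 : minSmoothness ℝ 2 ≤ ∞ := by
    rw [minSmoothness_of_isRCLikeNormedField]
    exact WithTop.coe_le_coe.2 (le_top : (2 : ℕ∞) ≤ ⊤)
  have jacobi := leibniz_identity_mlieBracket_apply (hX.contMDiffAt.of_le h2)
    (hY.contMDiffAt.of_le h2) (hZ.contMDiffAt.of_le h2)
  have key {U V W : VField I M} (hU : SmoothNear U x) (hV : SmoothNear V x)
      (hW : SmoothNear W x) :
      along D U (along D V W) x - along D U (along D W V) x - along D (mlieBracket I V W) U x
        = mlieBracket I U (mlieBracket I V W) x := by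
    rw [← along_sub_along hT hU.mdiffAt (hV.mlieBracket hW).mdiffAt,
      ← along_sub_right (hV.along hD hW).mdiffAt (hW.along hD hV).mdiffAt]
    congr 1
    refine along_congr_right ((hV.along hD hW).sub (hW.along hD hV)).mdiffAt
      (hV.mlieBracket hW).mdiffAt ?_
    filter_upwards [hV.eventually, hW.eventually] with y hV hW
      using along_sub_along hT hV.mdiffAt hW.mdiffAt
  have h₁ := key hX hY hZ
  have h₂ := key hY hZ hX
  have h₃ := key hZ hX hY
  rw [mlieBracket_swap_apply (V := mlieBracket I X Y),
    show mlieBracket I X Z = -mlieBracket I Z X from mlieBracket_swap,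
    show mlieBracket I Y (-mlieBracket I Z X) x = -mlieBracket I Y (mlieBracket I Z X) x by
      simpa using mlieBracket_const_smul_right (c := (-1 : ℝ)) (V := Y)
        (hZ.mlieBracket hX).mdiffAt, ← h₁, ← h₂, ← h₃, ← sub_eq_zero] at jacobi
  rw [← jacobi]
  simp only [curv1, Pi.sub_apply]
  abel

/-- The curvature operators of a metric connection are skew-adjoint. -/
theorem inner_curv1_self [Nontrivial E] {g : Metric I M} (hD : IsLeviCivita g D)
    (hX : SmoothNear X x) (hY : SmoothNear Y x) (hZ : SmoothNear Z x) :
    g.inner x (curv1 D X Y Z x) (Z x) = 0 := by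
  have hs := hD.smooth
  have d₁ {U : VField I M} : (fun y ↦ mvfderiv I (fun y ↦ g.inner y (Z y) (Z y)) y (U y))
      =ᶠ[𝓝 x] ((fun y ↦ g.inner y (along D U Z y) (Z y))
        + fun y ↦ g.inner y (along D U Z y) (Z y)) := by
    filter_upwards [hZ.eventually] with y hZ
    rw [hD.metric Z Z y hZ.mdiffAt hZ.mdiffAt, g.symm y (Z y)]
    rfl
  have i₁ {U : VField I M} (hU : SmoothNear U x) :
      MDiffAt (fun y ↦ g.inner y (along D U Z y) (Z y)) x :=
    (SmoothFunNear.inner g (hU.along hs hZ) hZ).mdiffAt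
  have i₂ {U : VField I M} (hU : SmoothNear U x) :
      MDiffAt (fun y ↦ mvfderiv I (fun y ↦ g.inner y (Z y) (Z y)) y (U y)) x :=
    ((i₁ hU).add (i₁ hU)).congr_of_eventuallyEq d₁
  have d₂ {U V : VField I M} (hV : SmoothNear V x) :
      mvfderiv I (fun y ↦ mvfderiv I (fun y ↦ g.inner y (Z y) (Z y)) y (V y)) x (U x)
        = 2 * (g.inner x (along D U (along D V Z) x) (Z x)
          + g.inner x (along D V Z x) (along D U Z x)) := by
    rw [mvfderiv, d₁.mfderiv_eq]
    change mvfderiv I _ x (U x) = _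
    rw [mvfderiv_add (i₁ hV) (i₁ hV), add_apply,
      hD.metric _ Z x (hV.along hs hZ).mdiffAt hZ.mdiffAt]
    simp only [along]
    ring
  have h := mvfderiv_commutator hX hY (SmoothFunNear.inner g hZ hZ) (i₂ hX) (i₂ hY)
  rw [d₂ hX, d₂ hY, hD.metric Z Z x hZ.mdiffAt hZ.mdiffAt, g.symm x (Z x),
    g.symm x (along D X Z x)] at h
  simp only [curv1, Pi.sub_apply, map_sub, sub_apply]
  simp only [along] at h ⊢
  linarith

theorem curv1_act {g : Metric I M} (hD : IsLeviCivita g D) {A : EndField I M}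
    (hA : IsKahlerStructure g D A)
    (hX : SmoothNear X x) (hY : SmoothNear Y x) (hZ : SmoothNear Z x) :
    curv1 D X Y (act A Z) x = A x (curv1 D X Y Z x) := by
  have hs := hD.smooth
  have key {U V : VField I M} (hV : SmoothNear V x) :
      along D U (along D V (act A Z)) x = A x (along D U (along D V Z) x) := by
    rw [along, along, ← hA.parallel _ x (hV.along hs hZ).mdiffAt,
      D.isCovariantDerivativeOnUniv.congr_of_eventuallyEq (hV.along hs (hZ.act hA.smooth)).mdiffAt
        ((hV.along hs hZ).act hA.smooth).mdiffAt univ_mem ?_]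
    filter_upwards [hZ.eventually] with y hZ using hA.parallel Z y hZ.mdiffAt _
  simp only [curv1, Pi.sub_apply, map_sub]
  rw [key hX, key hY]
  congr 1
  exact hA.parallel Z x hZ.mdiffAt _

end Curvature

section PointwiseTensors

variable {E : Type*} [NormedAddCommGroup E] [NormedSpace ℝ E] [FiniteDimensional ℝ E]
  {H : Type*} [TopologicalSpace H] {I : ModelWithCorners ℝ E H}
  {M : Type*} [TopologicalSpace M] [ChartedSpace H M] [IsManifold I ∞ M]
  {X X' Y Z W : VField I M} {f : M → ℝ} {x : M} {D : Connection I M}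

open VectorField

/-- The covariant derivative of a smooth 1-form is a bilinear form. -/
theorem exists_form_derivative {η : FormField I M} (hη : IsSmoothForm η) (D : Connection I M)
    (x : M) : ∃ β : TangentSpace I x →ₗ[ℝ] TangentSpace I x →ₗ[ℝ] ℝ,
      ∀ X Y : VField I M, MDiffAt (T% Y) x →
        mvfderiv I (fun y ↦ η y (Y y)) x (X x) = β (X x) (Y x) + η x (along D X Y x) := by
  have h : TensorialAt I E (fun Y : VField I M ↦
      mvfderiv I (fun y ↦ η y (Y y)) x - (η x).comp (D Y x)) x := by
    constructor
    · intro f Y hf hY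
      have : (fun y ↦ η y ((f • Y) y)) = f * fun y ↦ η y (Y y) := by
        ext y; simp
      rw [this, mvfderiv_mul hf (mdiffAt_form_apply hη hY),
        D.isCovariantDerivativeOn.leibniz (s := Set.univ) hY hf]
      ext v
      simp
      ring
    · intro Y Z hY hZ
      have : (fun y ↦ η y ((Y + Z) y)) = (fun y ↦ η y (Y y)) + fun y ↦ η y (Z y) := by
        ext y; simp
      rw [this, mvfderiv_add (mdiffAt_form_apply hη hY) (mdiffAt_form_apply hη hZ),
        D.isCovariantDerivativeOn.add (s := Set.univ) hY hZ]
      ext v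
      simp
      ring
  refine ⟨LinearMap.mk₂ ℝ (fun u v ↦ TensorialAt.mkHom _ x h v u) (by simp) (by simp) (by simp)
    (by simp), fun X Y hY ↦ ?_⟩
  rw [LinearMap.mk₂_apply, TensorialAt.mkHom_apply h hY]
  simp [along]

variable [T2Space M]

theorem curv1_add_left (hD : CovariantDerivative.ContMDiffCovariantDerivative D ∞)
    (hX : SmoothNear X x) (hX' : SmoothNear X' x) (hZ : SmoothNear Z x) :
    curv1 D (X + X') Y Z x = curv1 D X Y Z x + curv1 D X' Y Z x := by
  have h : along D (X + X') Z = along D X Z + along D X' Z := by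
    ext y; simp [along]
  simp only [curv1, Pi.sub_apply]
  rw [h, along_add_right (hX.along hD hZ).mdiffAt (hX'.along hD hZ).mdiffAt]
  simp only [along, Pi.add_apply, mlieBracket_add_left hX.mdiffAt hX'.mdiffAt, map_add]
  abel

theorem curv1_const_smul_left (hD : CovariantDerivative.ContMDiffCovariantDerivative D ∞)
    (hX : SmoothNear X x) (hZ : SmoothNear Z x) (c : ℝ) :
    curv1 D (c • X) Y Z x = c • curv1 D X Y Z x := by
  have h : along D (c • X) Z = c • along D X Z := by
    ext y; simp [along]
  simp only [curv1, Pi.sub_apply]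
  rw [h, along_const_smul_right c (hX.along hD hZ).mdiffAt]
  simp only [along, Pi.smul_apply, mlieBracket_const_smul_left hX.mdiffAt, map_smul]
  module

theorem inner_curv1_swap_right [Nontrivial E] {g : Metric I M} (hD : IsLeviCivita g D)
    (hX : SmoothNear X x) (hY : SmoothNear Y x) (hZ : SmoothNear Z x) (hW : SmoothNear W x) :
    g.inner x (curv1 D X Y Z x) (W x) = -g.inner x (curv1 D X Y W x) (Z x) := by
  have h := inner_curv1_self hD hX hY (hZ.add hW)
  rw [curv1_add_right hD.smooth hX hY hZ hW] at h
  simp only [Pi.add_apply, map_add, add_apply, inner_curv1_self hD hX hY hZ,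
    inner_curv1_self hD hX hY hW] at h
  linarith

theorem inner_curv1_pair [Nontrivial E] {g : Metric I M} (hD : IsLeviCivita g D)
    (hX : SmoothNear X x) (hY : SmoothNear Y x) (hZ : SmoothNear Z x) (hW : SmoothNear W x) :
    g.inner x (curv1 D X Y Z x) (W x) = g.inner x (curv1 D Z W X x) (Y x) := by
  have b {X Y Z : VField I M} (W : VField I M) (hX : SmoothNear X x) (hY : SmoothNear Y x)
      (hZ : SmoothNear Z x) : g.inner x (curv1 D X Y Z x) (W x)
        + g.inner x (curv1 D Y Z X x) (W x) + g.inner x (curv1 D Z X Y x) (W x) = 0 := by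
    have := congrArg (fun v ↦ g.inner x v (W x))
      (curv1_bianchi hD.smooth hD.torsion_eq_zero hX hY hZ)
    simpa using this
  have s (X Y Z W : VField I M) :
      g.inner x (curv1 D X Y Z x) (W x) = -g.inner x (curv1 D Y X Z x) (W x) := by
    rw [curv1_swap]; simp
  have b₁ := b W hX hY hZ
  have b₂ := b X hY hZ hW
  have b₃ := b Y hZ hW hX
  have b₄ := b Z hW hX hY
  have r₁ := inner_curv1_swap_right hD hX hY hZ hW
  have r₂ := inner_curv1_swap_right hD hY hZ hX hW
  have r₃ := inner_curv1_swap_right hD hZ hX hY hW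
  have r₄ := inner_curv1_swap_right hD hX hW hY hZ
  have r₅ := inner_curv1_swap_right hD hZ hW hX hY
  have r₆ := inner_curv1_swap_right hD hW hY hZ hX
  have s₁ := s X W Y Z
  have s₂ := s X W Z Y
  have s₃ := s X Y W Z
  have s₄ := s Y Z W X
  have s₅ := s Z X W Y
  have s₆ := s Y W Z X
  have s₇ := s Y W X Z
  have s₈ := s Z W Y X
  linarith

omit [FiniteDimensional ℝ E] [T2Space M] in
theorem eq_of_inner_eq (g : Metric I M) {u v : TangentSpace I x}
    (h : ∀ w, g.inner x u w = g.inner x v w) : u = v := by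
  by_contra hne
  have := g.pos x (u - v) (sub_ne_zero.2 hne)
  simp [h] at this

/-- The curvature of the Levi-Civita connection is a tensor. -/
theorem curv1_congr [Nontrivial E] {g : Metric I M} (hD : IsLeviCivita g D)
    {X Y Z X' Y' Z' : VField I M}
    (hX : SmoothNear X x) (hY : SmoothNear Y x) (hZ : SmoothNear Z x)
    (hX' : SmoothNear X' x) (hY' : SmoothNear Y' x) (hZ' : SmoothNear Z' x)
    (hXX' : X x = X' x) (hYY' : Y x = Y' x) (hZZ' : Z x = Z' x) :
    curv1 D X Y Z x = curv1 D X' Y' Z' x := by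
  have h₃ {X Y Z Z' : VField I M} (hX : SmoothNear X x) (hY : SmoothNear Y x)
      (hZ : SmoothNear Z x) (hZ' : SmoothNear Z' x) (h : Z x = Z' x) :
      curv1 D X Y Z x = curv1 D X Y Z' x := by
    refine eq_of_inner_eq g fun w ↦ ?_
    have hw : SmoothNear (FiberBundle.extend E w) x := SmoothNear.extend w
    have e := inner_curv1_swap_right hD hX hY hZ hw
    have e' := inner_curv1_swap_right hD hX hY hZ' hw
    rw [h] at e
    rw [← e'] at e
    simpa using e
  have h₁ {X Y Z X' : VField I M} (hX : SmoothNear X x) (hY : SmoothNear Y x)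
      (hZ : SmoothNear Z x) (hX' : SmoothNear X' x) (h : X x = X' x) :
      curv1 D X Y Z x = curv1 D X' Y Z x := by
    refine eq_of_inner_eq g fun w ↦ ?_
    have hw : SmoothNear (FiberBundle.extend E w) x := SmoothNear.extend w
    have e := inner_curv1_pair hD hX hY hZ hw
    have e' := inner_curv1_pair hD hX' hY hZ hw
    rw [h₃ hZ hw hX hX' h, ← e'] at e
    simpa using e
  rw [h₁ hX hY hZ hX' hXX', curv1_swap, Pi.neg_apply, h₁ hY hX' hZ hY' hYY', ← Pi.neg_apply,
    ← curv1_swap, h₃ hX' hY' hZ hZ' hZZ']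

theorem exists_curvature_tensor [Nontrivial E] {g : Metric I M} (hD : IsLeviCivita g D) (x : M) :
    ∃ R : TangentSpace I x →ₗ[ℝ] TangentSpace I x →ₗ[ℝ] TangentSpace I x →ₗ[ℝ] TangentSpace I x,
      ∀ X Y Z : VField I M, SmoothNear X x → SmoothNear Y x → SmoothNear Z x →
        curv1 D X Y Z x = R (X x) (Y x) (Z x) := by
  have hs := hD.smooth
  let e (v : TangentSpace I x) : VField I M := FiberBundle.extend E v
  have he (v : TangentSpace I x) : SmoothNear (e v) x := SmoothNear.extend v
  have hex (v : TangentSpace I x) : e v x = v := by simp [e]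
  have a₁ (u u' v w) : curv1 D (e (u + u')) (e v) (e w) x
      = curv1 D (e u) (e v) (e w) x + curv1 D (e u') (e v) (e w) x := by
    rw [← curv1_add_left hs (he u) (he u') (he w)]
    exact curv1_congr hD (he _) (he _) (he _) ((he u).add (he u')) (he _) (he _)
      (by simp [hex]) rfl rfl
  have m₁ (c : ℝ) (u v w) : curv1 D (e (c • u)) (e v) (e w) x
      = c • curv1 D (e u) (e v) (e w) x := by
    rw [← curv1_const_smul_left hs (he u) (he w)]
    exact curv1_congr hD (he _) (he _) (he _) ((he u).const_smul c) (he _) (he _)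
      (by simp [hex]) rfl rfl
  have a₃ (u v w w') : curv1 D (e u) (e v) (e (w + w')) x
      = curv1 D (e u) (e v) (e w) x + curv1 D (e u) (e v) (e w') x := by
    rw [← curv1_add_right hs (he u) (he v) (he w) (he w')]
    exact curv1_congr hD (he _) (he _) (he _) (he _) (he _) ((he w).add (he w')) rfl rfl
      (by simp [hex])
  have m₃ (c : ℝ) (u v w) : curv1 D (e u) (e v) (e (c • w)) x
      = c • curv1 D (e u) (e v) (e w) x := by
    rw [← curv1_const_smul_right hs (he u) (he v) (he w)]
    exact curv1_congr hD (he _) (he _) (he _) (he _) (he _) ((he w).const_smul c) rfl rfl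
      (by simp [hex])
  have s (u v w) : curv1 D (e u) (e v) (e w) x = -curv1 D (e v) (e u) (e w) x := by
    rw [curv1_swap, Pi.neg_apply]
  refine ⟨LinearMap.mk₂ ℝ (fun u v ↦
    { toFun := fun w ↦ curv1 D (e u) (e v) (e w) x
      map_add' := a₃ u v
      map_smul' := fun c ↦ m₃ c u v }) ?_ ?_ ?_ ?_, fun X Y Z hX hY hZ ↦ ?_⟩
  · intro u u' v
    ext w
    exact a₁ u u' v w
  · intro c u v
    ext w
    exact m₁ c u v w
  · intro u v v'
    ext w
    change curv1 D (e u) (e (v + v')) (e w) x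
      = curv1 D (e u) (e v) (e w) x + curv1 D (e u) (e v') (e w) x
    rw [s, a₁, s u v, s u v']
    abel
  · intro c u v
    ext w
    change curv1 D (e u) (e (c • v)) (e w) x = c • curv1 D (e u) (e v) (e w) x
    rw [s, m₁, s u v, smul_neg]
  · exact curv1_congr hD hX hY hZ (he _) (he _) (he _) (hex _).symm (hex _).symm (hex _).symm

end PointwiseTensors

section Algebra

variable {V : Type*} [AddCommGroup V] [Module ℝ V] [FiniteDimensional ℝ V]

theorem trace_eq_zero_of_skew (g : V →ₗ[ℝ] V →ₗ[ℝ] ℝ)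
    (hg : ∀ v, v ≠ 0 → 0 < g v v) (f : V →ₗ[ℝ] V) (hf : ∀ v w, g (f v) w = -g v (f w)) :
    LinearMap.trace ℝ V f = 0 := by
  have hinj : Function.Injective g := by
    rw [injective_iff_map_eq_zero]
    intro v hv
    by_contra hne
    have := hg v hne
    simp [hv] at this
  let e : V ≃ₗ[ℝ] Dual ℝ V :=
    LinearEquiv.ofInjectiveOfFinrankEq g hinj Subspace.dual_finrank_eq.symm
  have he : e.conj f = -Module.Dual.transpose (R := ℝ) f := by
    ext φ w
    obtain ⟨v, rfl⟩ := e.surjective φ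
    have : ∀ u w, e u w = g u w := fun u w ↦ rfl
    simp [LinearEquiv.conj_apply, this, hf, Module.Dual.transpose_apply]
  have h := LinearMap.trace_conj' f e
  rw [he] at h
  have h' := h.symm.trans (map_neg (LinearMap.trace ℝ (Dual ℝ V)) (Module.Dual.transpose f))
  rw [LinearMap.trace_transpose'] at h'
  linarith

/-- The Ricci form `(y, z) ↦ Trace {x ↦ R(x, y) z}` of a trilinear map. -/
def ricciForm (R : V →ₗ[ℝ] V →ₗ[ℝ] V →ₗ[ℝ] V) : V →ₗ[ℝ] V →ₗ[ℝ] ℝ :=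
  LinearMap.mk₂ ℝ (fun y z ↦ LinearMap.trace ℝ V ((R.flip y).flip z))
    (fun y y' z ↦ by
      rw [map_add R.flip]; exact map_add _ ((R.flip y).flip z) ((R.flip y').flip z))
    (fun c y z ↦ by
      rw [map_smul R.flip]; exact map_smul _ c ((R.flip y).flip z))
    (fun y z z' ↦ by rw [map_add, map_add])
    (fun c y z ↦ by rw [map_smul, map_smul])

/-- The algebraic properties of the curvature tensor `R` and the complex structure `A` of a Kähler
manifold at a point. -/
structure IsKahlerCurvature (A : V →ₗ[ℝ] V) (R : V →ₗ[ℝ] V →ₗ[ℝ] V →ₗ[ℝ] V) : Prop where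
  sq (v : V) : A (A v) = -v
  trace_eq_zero : LinearMap.trace ℝ V A = 0
  swap (x y z : V) : R x y z = -R y x z
  bianchi (x y z : V) : R x y z + R y z x + R z x y = 0
  trace_curv (x y : V) : LinearMap.trace ℝ V (R x y) = 0
  ricci_symm (y z : V) : ricciForm R y z = ricciForm R z y
  ricci_map_right (y z : V) : ricciForm R y (A z) = -ricciForm R (A y) z

theorem isKahlerCurvature_of_inner (g : V →ₗ[ℝ] V →ₗ[ℝ] ℝ) (hsymm : ∀ v w, g v w = g w v)
    (hg : ∀ v, v ≠ 0 → 0 < g v v) {A : V →ₗ[ℝ] V} {R : V →ₗ[ℝ] V →ₗ[ℝ] V →ₗ[ℝ] V}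
    (hA : ∀ v, A (A v) = -v) (hgA : ∀ v w, g (A v) (A w) = g v w)
    (hswap : ∀ x y z, R x y z = -R y x z) (hbianchi : ∀ x y z, R x y z + R y z x + R z x y = 0)
    (hskew : ∀ x y z w, g (R x y z) w = -g (R x y w) z)
    (hpair : ∀ x y z w, g (R x y z) w = g (R z w x) y)
    (hRA : ∀ x y z, R x y (A z) = A (R x y z)) : IsKahlerCurvature A R := by
  have hRAA (x y z : V) : R (A x) (A y) z = R x y z := by
    rw [← sub_eq_zero]
    by_contra hne
    have := hg _ hne
    set w := R (A x) (A y) z - R x y z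
    have h : g (R (A x) (A y) z) w = g (R x y z) w := by
      rw [hpair, hRA, hgA, ← hpair]
    have hw : g w w = g (R (A x) (A y) z) w - g (R x y z) w := by
      rw [← LinearMap.sub_apply, ← map_sub]
    rw [hw, h] at this
    simp at this
  have hRA' (x y z : V) : R x (A y) z = -R (A x) y z := by
    have := hRAA x (A y) z
    rw [hA] at this
    simpa using this.symm
  have htrace (x y : V) : LinearMap.trace ℝ V (R x y) = 0 :=
    trace_eq_zero_of_skew g hg _ fun v w ↦ by rw [hskew, hsymm]
  have hform (y z : V) : ricciForm R y z = LinearMap.trace ℝ V ((R.flip y).flip z) := rfl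
  refine ⟨hA, trace_eq_zero_of_skew g hg A fun v w ↦ ?_, hswap, hbianchi, htrace,
    fun y z ↦ ?_, fun y z ↦ ?_⟩
  · rw [← hgA v, hA]; simp
  · have : (R.flip y).flip z = (R.flip z).flip y + R y z * (-1 : ℝ) • 1 := by
      ext x
      have h₁ := hbianchi x y z
      have h₂ := hswap z x y
      simp only [LinearMap.flip_apply, LinearMap.add_apply, Module.End.mul_apply,
        LinearMap.smul_apply, Module.End.one_apply, map_smul]
      rw [← sub_eq_zero, ← h₁, h₂]
      module
    rw [hform, this, map_add, mul_smul_comm, mul_one, map_smul, htrace, smul_zero, add_zero, hform]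
  · have : (R.flip y).flip (A z) = A ∘ₗ (R.flip y).flip z := by
      ext x
      simp [hRA]
    rw [hform, this, LinearMap.trace_comp_comm', hform, ← map_neg]
    congr 1
    ext x
    simp [hRA']

variable {A : V →ₗ[ℝ] V} {R : V →ₗ[ℝ] V →ₗ[ℝ] V →ₗ[ℝ] V} {β : V →ₗ[ℝ] V →ₗ[ℝ] ℝ} {η : V →ₗ[ℝ] ℝ}

variable (A R β η)

/-! The values at a point of the six curvature tensors of the quarter-symmetric connection, in
terms of the curvature `R` of the Levi-Civita connection and the covariant derivative `β` of the
generator `η`. -/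

/-- The curvature tensor `R⁰` at a point. -/
def tensor0 (x y z : V) : V :=
  R x y z - ((β x y - β y x) / 2) • A z - (β x z / 2) • A y + (β y z / 2) • A x
    - (η x * η z / 4) • y + (η y * η z / 4) • x
    + ((η y * η (A z) + η z * η (A y)) / 4) • A x - ((η x * η (A z) + η z * η (A x)) / 4) • A y

/-- The curvature tensor `R¹` at a point. -/
def tensor1 (x y z : V) : V := R x y z - (β x y - β y x) • A z

/-- The curvature tensor `R²` at a point. -/
def tensor2 (x y z : V) : V :=
  R x y z - β x z • A y + β y z • A x + (η z * η (A y)) • A x - (η z * η (A x)) • A y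

/-- The curvature tensor `R³` at a point. -/
def tensor3 (x y z : V) : V :=
  R x y z - β x y • A z + β y z • A x + (η y * η (A z)) • A x - (η y * η (A x)) • A z

/-- The curvature tensor `R⁴` at a point. -/
def tensor4 (x y z : V) : V :=
  R x y z - β x y • A z + β y z • A x + (η y * η (A z)) • A x - (η x * η (A y)) • A z
    + (η y * η z) • x - (η x * η z) • y

/-- The curvature tensor `R⁵` at a point. -/
def tensor5 (x y z : V) : V :=
  R x y z + (1 / 2 : ℝ) • (-(β x y - β y x) • A z - β x z • A y + β y z • A x
    - (η x * η y) • z - (η x * η (A z)) • A y + (η z * η (A y)) • A x + (η y * η z) • x)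

variable {A R}

open LinearMap in
theorem IsKahlerCurvature.trace_tensor0 (h : IsKahlerCurvature A R) (y z : V) :
    ∃ f : V →ₗ[ℝ] V, (∀ x, f x = tensor0 A R β η x y z) ∧
      LinearMap.trace ℝ V f = ricciForm R y z - (β (A z) y - β y (A z)) / 2 - β (A y) z / 2
        + finrank ℝ V * (η y * η z) / 4 - η (A y) * η (A z) / 4 := by
  refine ⟨(R.flip y).flip z - (1 / 2 : ℝ) • (β.flip y - β y).smulRight (A z)
    - (1 / 2 : ℝ) • (β.flip z).smulRight (A y) + (β y z / 2) • A
    - (η z / 4) • η.smulRight y + (η y * η z / 4) • LinearMap.id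
    + ((η y * η (A z) + η z * η (A y)) / 4) • A
    - (η (A z) / 4) • η.smulRight (A y) - (η z / 4) • (η ∘ₗ A).smulRight (A y),
    fun x ↦ ?_, ?_⟩
  · simp [tensor0]
    module
  · simp only [map_add, map_sub, map_smul, trace_smulRight, trace_id, h.trace_eq_zero]
    simp [h.sq, ricciForm]
    ring

open LinearMap in
theorem IsKahlerCurvature.trace_tensor1 (_h : IsKahlerCurvature A R) (y z : V) :
    ∃ f : V →ₗ[ℝ] V, (∀ x, f x = tensor1 A R β x y z) ∧
      LinearMap.trace ℝ V f = ricciForm R y z - (β (A z) y - β y (A z)) := by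
  refine ⟨(R.flip y).flip z - (β.flip y - β y).smulRight (A z), fun x ↦ ?_, ?_⟩
  · simp [tensor1]
  · simp only [map_sub, trace_smulRight]
    simp [ricciForm]

open LinearMap in
theorem IsKahlerCurvature.trace_tensor2 (h : IsKahlerCurvature A R) (y z : V) :
    ∃ f : V →ₗ[ℝ] V, (∀ x, f x = tensor2 A R β η x y z) ∧
      LinearMap.trace ℝ V f = ricciForm R y z - β (A y) z + η y * η z := by
  refine ⟨(R.flip y).flip z - (β.flip z).smulRight (A y) + (β y z) • A + (η z * η (A y)) • A
    - η z • (η ∘ₗ A).smulRight (A y), fun x ↦ ?_, ?_⟩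
  · simp [tensor2]
    module
  · simp only [map_add, map_sub, map_smul, trace_smulRight, h.trace_eq_zero]
    simp [h.sq, ricciForm]
    ring

open LinearMap in
theorem IsKahlerCurvature.trace_tensor3 (h : IsKahlerCurvature A R) (y z : V) :
    ∃ f : V →ₗ[ℝ] V, (∀ x, f x = tensor3 A R β η x y z) ∧
      LinearMap.trace ℝ V f = ricciForm R y z - β (A z) y + η y * η z := by
  refine ⟨(R.flip y).flip z - (β.flip y).smulRight (A z) + (β y z) • A + (η y * η (A z)) • A
    - η y • (η ∘ₗ A).smulRight (A z), fun x ↦ ?_, ?_⟩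
  · simp [tensor3]
    module
  · simp only [map_add, map_sub, map_smul, trace_smulRight, h.trace_eq_zero]
    simp [h.sq, ricciForm]

open LinearMap in
theorem IsKahlerCurvature.trace'_tensor3 (h : IsKahlerCurvature A R) (x y : V) :
    ∃ f : V →ₗ[ℝ] V, (∀ z, f z = tensor3 A R β η x y z) ∧
      LinearMap.trace ℝ V f = β y (A x) - η x * η y := by
  refine ⟨R x y - β x y • A + (β y).smulRight (A x) + η y • (η ∘ₗ A).smulRight (A x)
    - (η y * η (A x)) • A, fun z ↦ ?_, ?_⟩
  · simp [tensor3]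
    module
  · simp only [map_add, map_sub, map_smul, trace_smulRight, h.trace_eq_zero, h.trace_curv]
    simp [h.sq]
    ring

open LinearMap in
theorem IsKahlerCurvature.trace_tensor4 (h : IsKahlerCurvature A R) (y z : V) :
    ∃ f : V →ₗ[ℝ] V, (∀ x, f x = tensor4 A R β η x y z) ∧
      LinearMap.trace ℝ V f = ricciForm R y z - β (A z) y + (finrank ℝ V - 1) * (η y * η z)
        - η (A y) * η (A z) := by
  refine ⟨(R.flip y).flip z - (β.flip y).smulRight (A z) + (β y z) • A + (η y * η (A z)) • A
    - η (A y) • η.smulRight (A z) + (η y * η z) • LinearMap.id - η z • η.smulRight y,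
    fun x ↦ ?_, ?_⟩
  · simp [tensor4]
    module
  · simp only [map_add, map_sub, map_smul, trace_smulRight, trace_id, h.trace_eq_zero]
    simp [ricciForm]
    ring

open LinearMap in
theorem IsKahlerCurvature.trace'_tensor4 (h : IsKahlerCurvature A R) (x y : V) :
    ∃ f : V →ₗ[ℝ] V, (∀ z, f z = tensor4 A R β η x y z) ∧
      LinearMap.trace ℝ V f = β y (A x) - η x * η y := by
  refine ⟨R x y - β x y • A + (β y).smulRight (A x) + η y • (η ∘ₗ A).smulRight (A x)
    - (η x * η (A y)) • A + η y • η.smulRight x - η x • η.smulRight y, fun z ↦ ?_, ?_⟩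
  · simp [tensor4]
    module
  · simp only [map_add, map_sub, map_smul, trace_smulRight, h.trace_eq_zero, h.trace_curv]
    simp [h.sq]

open LinearMap in
theorem IsKahlerCurvature.trace_tensor5 (h : IsKahlerCurvature A R) (y z : V) :
    ∃ f : V →ₗ[ℝ] V, (∀ x, f x = tensor5 A R β η x y z) ∧
      LinearMap.trace ℝ V f = ricciForm R y z + (-(β (A z) y - β y (A z)) - β (A y) z
        + (finrank ℝ V - 1) * (η y * η z) - η (A y) * η (A z)) / 2 := by
  refine ⟨(R.flip y).flip z + (1 / 2 : ℝ) • (-(β.flip y - β y).smulRight (A z)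
    - (β.flip z).smulRight (A y) + β y z • A - η y • η.smulRight z - η (A z) • η.smulRight (A y)
    + (η z * η (A y)) • A + (η y * η z) • LinearMap.id), fun x ↦ ?_, ?_⟩
  · simp [tensor5]
    module
  · simp only [map_add, map_sub, map_neg, map_smul, trace_smulRight, trace_id, h.trace_eq_zero]
    simp [ricciForm]
    ring

end Algebra

section Connections

variable {E : Type*} [NormedAddCommGroup E] [NormedSpace ℝ E] [FiniteDimensional ℝ E]
  {H : Type*} [TopologicalSpace H] {I : ModelWithCorners ℝ E H}
  {M : Type*} [TopologicalSpace M] [ChartedSpace H M] [IsManifold I ∞ M]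
  {D : Connection I M} {A : EndField I M} {η : FormField I M}
  {g : Metric I M} {X Y Z : VField I M} {x : M}

open VectorField

omit [FiniteDimensional ℝ E] in
theorem along_quarterSymmetric (X Y : VField I M) :
    along (quarterSymmetric D A η) X Y = along D X Y - (fun y ↦ η y (X y)) • act A Y := by
  ext y
  simp [along, quarterSymmetric, act]

theorem torsion_quarterSymmetric (hT : D.torsion = 0) (u v : TangentSpace I x) :
    (quarterSymmetric D A η).torsion x u v = η x v • A x u - η x u • A x v := by
  have h : D.torsion x u v = 0 := by rw [hT]; rfl
  rw [CovariantDerivative.torsion_apply_eq_extend] at h ⊢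
  simp only [quarterSymmetric, sub_apply, ContinuousLinearMap.smulRight_apply,
    FiberBundle.extend_apply_self] at h ⊢
  rw [← sub_eq_zero, ← h]
  module

theorem along_opposite_quarterSymmetric (hT : D.torsion = 0) (X Y : VField I M) :
    along (opposite (quarterSymmetric D A η)) X Y
      = along D X Y - (fun y ↦ η y (Y y)) • act A X := by
  ext y
  change quarterSymmetric D A η Y y (X y) + (quarterSymmetric D A η).torsion y (Y y) (X y) = _
  rw [torsion_quarterSymmetric hT]
  simp [along, quarterSymmetric, act]

theorem along_symmetrized_quarterSymmetric (hT : D.torsion = 0) (X Y : VField I M) :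
    along (symmetrized (quarterSymmetric D A η)) X Y
      = along D X Y - (1 / 2 : ℝ) • ((fun y ↦ η y (X y)) • act A Y)
        - (1 / 2 : ℝ) • ((fun y ↦ η y (Y y)) • act A X) := by
  ext y
  rw [along_symmetrized, along_quarterSymmetric, along_opposite_quarterSymmetric hT]
  simp only [Pi.sub_apply, Pi.smul_apply]
  module

variable [T2Space M]

section Expansion

variable {β : TangentSpace I x →ₗ[ℝ] TangentSpace I x →ₗ[ℝ] ℝ}

omit [FiniteDimensional ℝ E] [T2Space M] in
theorem along_form_smul_act (hA : IsKahlerStructure g D A)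
    (hη : IsSmoothForm η)
    (hβ : ∀ X Y : VField I M, MDiffAt (T% Y) x →
      mvfderiv I (fun y ↦ η y (Y y)) x (X x) = β (X x) (Y x) + η x (along D X Y x))
    (X : VField I M) (hY : SmoothNear Y x) (hZ : SmoothNear Z x) :
    along D X ((fun y ↦ η y (Y y)) • act A Z) x
      = η x (Y x) • A x (along D X Z x)
        + (β (X x) (Y x) + η x (along D X Y x)) • A x (Z x) := by
  rw [along_smul_right (mdiffAt_form_apply hη hY.mdiffAt) (hZ.act hA.smooth).mdiffAt,
    hβ X Y hY.mdiffAt, along, hA.parallel Z x hZ.mdiffAt]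
  rfl

omit [FiniteDimensional ℝ E] [T2Space M] in
theorem mdiffAt_form_smul_act (hA : IsKahlerStructure g D A) (hη : IsSmoothForm η)
    (hY : SmoothNear Y x) (hZ : SmoothNear Z x) :
    MDiffAt (T% ((fun y ↦ η y (Y y)) • act A Z)) x :=
  (mdiffAt_form_apply hη hY.mdiffAt).smul_section (hZ.act hA.smooth).mdiffAt

theorem along_along_quarterSymmetric (hD : IsLeviCivita g D) (hA : IsKahlerStructure g D A)
    (hη : IsSmoothForm η)
    (hβ : ∀ X Y : VField I M, MDiffAt (T% Y) x →
      mvfderiv I (fun y ↦ η y (Y y)) x (X x) = β (X x) (Y x) + η x (along D X Y x))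
    (X : VField I M) (hY : SmoothNear Y x) (hZ : SmoothNear Z x) (a b : ℝ) :
    along D X (along D Y Z - a • ((fun y ↦ η y (Y y)) • act A Z)
        - b • ((fun y ↦ η y (Z y)) • act A Y)) x
      = along D X (along D Y Z) x
        - a • (η x (Y x) • A x (along D X Z x)
          + (β (X x) (Y x) + η x (along D X Y x)) • A x (Z x))
        - b • (η x (Z x) • A x (along D X Y x)
          + (β (X x) (Z x) + η x (along D X Z x)) • A x (Y x)) := by
  have h₀ := (hY.along hD.smooth hZ).mdiffAt
  have h₁ := mdiffAt_form_smul_act hA hη hY hZ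
  have h₂ := mdiffAt_form_smul_act hA hη hZ hY
  have h₁' : MDiffAt (T% (a • ((fun y ↦ η y (Y y)) • act A Z))) x :=
    (mdifferentiableAt_const (c := a)).smul_section h₁
  have h₂' : MDiffAt (T% (b • ((fun y ↦ η y (Z y)) • act A Y))) x :=
    (mdifferentiableAt_const (c := b)).smul_section h₂
  have h₃ : MDiffAt (T% (along D Y Z - a • ((fun y ↦ η y (Y y)) • act A Z))) x :=
    mdifferentiableAt_sub_section h₀ h₁'
  rw [along_sub_right h₃ h₂', along_sub_right h₀ h₁', along_const_smul_right _ h₁,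
    along_const_smul_right _ h₂, along_form_smul_act hA hη hβ X hY hZ,
    along_form_smul_act hA hη hβ X hZ hY]

theorem along_along_quarterSymmetric_left (hD : IsLeviCivita g D) (hA : IsKahlerStructure g D A)
    (hη : IsSmoothForm η)
    (hβ : ∀ X Y : VField I M, MDiffAt (T% Y) x →
      mvfderiv I (fun y ↦ η y (Y y)) x (X x) = β (X x) (Y x) + η x (along D X Y x))
    (X : VField I M) (hY : SmoothNear Y x) (hZ : SmoothNear Z x) :
    along D X (along D Y Z - (fun y ↦ η y (Y y)) • act A Z) x
      = along D X (along D Y Z) x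
        - (η x (Y x) • A x (along D X Z x)
          + (β (X x) (Y x) + η x (along D X Y x)) • A x (Z x)) := by
  simpa using along_along_quarterSymmetric hD hA hη hβ X hY hZ 1 0

theorem along_along_quarterSymmetric_right (hD : IsLeviCivita g D) (hA : IsKahlerStructure g D A)
    (hη : IsSmoothForm η)
    (hβ : ∀ X Y : VField I M, MDiffAt (T% Y) x →
      mvfderiv I (fun y ↦ η y (Y y)) x (X x) = β (X x) (Y x) + η x (along D X Y x))
    (X : VField I M) (hY : SmoothNear Y x) (hZ : SmoothNear Z x) :
    along D X (along D Y Z - (fun y ↦ η y (Z y)) • act A Y) x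
      = along D X (along D Y Z) x
        - (η x (Z x) • A x (along D X Y x)
          + (β (X x) (Z x) + η x (along D X Z x)) • A x (Y x)) := by
  simpa using along_along_quarterSymmetric hD hA hη hβ X hY hZ 0 1

theorem curv_quarterSymmetric (hD : IsLeviCivita g D) (hA : IsKahlerStructure g D A)
    (hη : IsSmoothForm η)
    (hβ : ∀ X Y : VField I M, MDiffAt (T% Y) x →
      mvfderiv I (fun y ↦ η y (Y y)) x (X x) = β (X x) (Y x) + η x (along D X Y x))
    {R : TangentSpace I x →ₗ[ℝ] TangentSpace I x →ₗ[ℝ] TangentSpace I x →ₗ[ℝ] TangentSpace I x}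
    (hR : ∀ X Y Z : VField I M, SmoothNear X x → SmoothNear Y x → SmoothNear Z x →
        curv1 D X Y Z x = R (X x) (Y x) (Z x))
    (hX : SmoothNear X x) (hY : SmoothNear Y x) (hZ : SmoothNear Z x) :
    curv0 (quarterSymmetric D A η) X Y Z x
        = tensor0 (A x : TangentSpace I x →ₗ[ℝ] TangentSpace I x) R β (η x) (X x) (Y x) (Z x) ∧
      curv1 (quarterSymmetric D A η) X Y Z x
        = tensor1 (A x : TangentSpace I x →ₗ[ℝ] TangentSpace I x) R β (X x) (Y x) (Z x) ∧
      curv2 (quarterSymmetric D A η) X Y Z x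
        = tensor2 (A x : TangentSpace I x →ₗ[ℝ] TangentSpace I x) R β (η x) (X x) (Y x) (Z x) ∧
      curv3 (quarterSymmetric D A η) X Y Z x
        = tensor3 (A x : TangentSpace I x →ₗ[ℝ] TangentSpace I x) R β (η x) (X x) (Y x) (Z x) ∧
      curv4 (quarterSymmetric D A η) X Y Z x
        = tensor4 (A x : TangentSpace I x →ₗ[ℝ] TangentSpace I x) R β (η x) (X x) (Y x) (Z x) ∧
      curv5 (quarterSymmetric D A η) X Y Z x
        = tensor5 (A x : TangentSpace I x →ₗ[ℝ] TangentSpace I x) R β (η x) (X x) (Y x) (Z x) := by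
  have hT := hD.torsion_eq_zero
  have hb := along_sub_along hT hX.mdiffAt hY.mdiffAt
  have hsq := hA.sq_eq_neg x
  have R' : R (X x) (Y x) (Z x) = along D X (along D Y Z) x - along D Y (along D X Z) x
      - (D Z x (D Y x (X x)) - D Z x (D X x (Y x))) := by
    rw [← hR X Y Z hX hY hZ, curv1, ← map_sub]
    simp only [Pi.sub_apply]
    rw [along, along, along, ← hb]
    rfl
  have eXY := along_along_quarterSymmetric hD hA hη hβ X hY hZ (1 / 2) (1 / 2)
  have eYX := along_along_quarterSymmetric hD hA hη hβ Y hX hZ (1 / 2) (1 / 2)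
  have lXY := along_along_quarterSymmetric_left hD hA hη hβ X hY hZ
  have lYX := along_along_quarterSymmetric_left hD hA hη hβ Y hX hZ
  have rXY := along_along_quarterSymmetric_right hD hA hη hβ X hY hZ
  have rYX := along_along_quarterSymmetric_right hD hA hη hβ Y hX hZ
  generalize along D X (along D Y Z) x = p at *
  generalize along D Y (along D X Z) x = q at *
  refine ⟨?_, ?_, ?_, ?_, ?_, ?_⟩
  all_goals
    simp only [curv0, curv1, curv2, curv3, curv4, curv5, tensor0, tensor1, tensor2, tensor3,
      tensor4, tensor5, along_quarterSymmetric, along_opposite_quarterSymmetric hT,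
      along_symmetrized_quarterSymmetric hT, Pi.sub_apply, Pi.add_apply, Pi.smul_apply,
      Pi.smul_apply', eXY, eYX, lXY, lYX, rXY, rYX, R']
    simp only [along, act, Pi.sub_apply, Pi.smul_apply, Pi.smul_apply', map_sub, map_smul, hsq,
      ContinuousLinearMap.coe_coe, ← hb, smul_eq_mul]
    module

end Expansion

end Connections

section Main

variable {E : Type*} [NormedAddCommGroup E] [NormedSpace ℝ E] [FiniteDimensional ℝ E]
  {H : Type*} [TopologicalSpace H] {I : ModelWithCorners ℝ E H}
  {M : Type*} [TopologicalSpace M] [ChartedSpace H M] [IsManifold I ∞ M]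
  {x : M}

section Traces

variable {K : VField I M → VField I M → VField I M → VField I M}
  {T : TangentSpace I x → TangentSpace I x → TangentSpace I x → TangentSpace I x}

theorem ricci_eq_of_exists
    (hK : ∀ X Y Z : VField I M, SmoothNear X x → SmoothNear Y x → SmoothNear Z x →
      K X Y Z x = T (X x) (Y x) (Z x)) {r : TangentSpace I x → TangentSpace I x → ℝ}
    (hr : ∀ y z, ∃ f : TangentSpace I x →ₗ[ℝ] TangentSpace I x, (∀ v, f v = T v y z) ∧
      LinearMap.trace ℝ (TangentSpace I x) f = r y z)
    (Y Z : VField I M) (hY : SmoothNear Y x) (hZ : SmoothNear Z x) :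
    ricci K Y Z x = r (Y x) (Z x) := by
  obtain ⟨f, hf, h⟩ := hr (Y x) (Z x)
  rw [← h]
  refine fieldTrace_eq_trace _ x f fun v ↦ ?_
  rw [hf, hK _ _ _ (SmoothNear.extend v) hY hZ, FiberBundle.extend_apply_self]

theorem ricci'_eq_of_exists
    (hK : ∀ X Y Z : VField I M, SmoothNear X x → SmoothNear Y x → SmoothNear Z x →
      K X Y Z x = T (X x) (Y x) (Z x)) {r : TangentSpace I x → TangentSpace I x → ℝ}
    (hr : ∀ y z, ∃ f : TangentSpace I x →ₗ[ℝ] TangentSpace I x, (∀ v, f v = T y z v) ∧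
      LinearMap.trace ℝ (TangentSpace I x) f = r y z)
    (Y Z : VField I M) (hY : SmoothNear Y x) (hZ : SmoothNear Z x) :
    ricci' K Y Z x = r (Y x) (Z x) := by
  obtain ⟨f, hf, h⟩ := hr (Y x) (Z x)
  rw [← h]
  refine fieldTrace_eq_trace _ x f fun v ↦ ?_
  rw [hf, hK _ _ _ hY hZ (SmoothNear.extend v), FiberBundle.extend_apply_self]

end Traces

theorem isKahlerCurvature_curvature [T2Space M] [Nontrivial E] {g : Metric I M} {D : Connection I M}
    (hD : IsLeviCivita g D) {A : EndField I M} (hA : IsKahlerStructure g D A)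
    {R : TangentSpace I x →ₗ[ℝ] TangentSpace I x →ₗ[ℝ] TangentSpace I x →ₗ[ℝ] TangentSpace I x}
    (hR : ∀ X Y Z : VField I M, SmoothNear X x → SmoothNear Y x → SmoothNear Z x →
        curv1 D X Y Z x = R (X x) (Y x) (Z x)) :
    IsKahlerCurvature (A x : TangentSpace I x →ₗ[ℝ] TangentSpace I x) R := by
  let e (v : TangentSpace I x) : VField I M := FiberBundle.extend E v
  have he (v : TangentSpace I x) : SmoothNear (e v) x := SmoothNear.extend v
  have hex (v : TangentSpace I x) : e v x = v := by simp [e]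
  have hRe (u v w) : R u v w = curv1 D (e u) (e v) (e w) x := by
    rw [hR _ _ _ (he u) (he v) (he w), hex, hex, hex]
  let G : TangentSpace I x →ₗ[ℝ] TangentSpace I x →ₗ[ℝ] ℝ :=
    LinearMap.mk₂ ℝ (fun v w ↦ g.inner x v w) (by simp) (by simp) (by simp) (by simp)
  refine isKahlerCurvature_of_inner G (fun v w ↦ g.symm x v w) (fun v hv ↦ g.pos x v hv)
    (hA.sq_eq_neg x) (hA.inner_eq x) (fun u v w ↦ ?_) (fun u v w ↦ ?_) (fun u v w z ↦ ?_)
    (fun u v w z ↦ ?_) (fun u v w ↦ ?_)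
  · rw [hRe, hRe, curv1_swap, Pi.neg_apply]
  · rw [hRe, hRe, hRe]
    exact curv1_bianchi hD.smooth hD.torsion_eq_zero (he u) (he v) (he w)
  · have := inner_curv1_swap_right hD (he u) (he v) (he w) (he z)
    rwa [← hRe, ← hRe, hex, hex] at this
  · have := inner_curv1_pair hD (he u) (he v) (he w) (he z)
    rwa [← hRe, ← hRe, hex, hex] at this
  · have h := curv1_act hD hA (he u) (he v) (he w)
    rw [hR _ _ _ (he u) (he v) ((he w).act hA.smooth), ← hRe, act, hex, hex, hex] at h
    exact h

end Main

end QuarterSymmetric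

end

open QuarterSymmetric in
theorem mainTheorem4
    {E : Type*} [NormedAddCommGroup E] [NormedSpace ℝ E] [FiniteDimensional ℝ E]
    {H : Type*} [TopologicalSpace H] (I : ModelWithCorners ℝ E H)
    (M : Type*) [TopologicalSpace M] [T2Space M] [SecondCountableTopology M]
    [ChartedSpace H M] [IsManifold I ∞ M] [BoundarylessManifold I M]
    (n : ℕ) (hdim : Module.finrank ℝ E = n) (hn : 4 ≤ n)
    (g : QuarterSymmetric.Metric I M)
    (D : QuarterSymmetric.Connection I M) (hD : QuarterSymmetric.IsLeviCivita g D)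
    (A : QuarterSymmetric.EndField I M) (hA : QuarterSymmetric.IsKahlerStructure g D A)
    (η : QuarterSymmetric.FormField I M) (hη : QuarterSymmetric.IsSmoothForm η)
    (D1 : QuarterSymmetric.Connection I M)
    (hD1 : D1 = QuarterSymmetric.quarterSymmetric D A η)
    (X Y Z : QuarterSymmetric.VField I M)
    (hX : ContMDiff I I.tangent ∞ (T% X)) (hY : ContMDiff I I.tangent ∞ (T% Y))
    (hZ : ContMDiff I I.tangent ∞ (T% Z)) :
    QuarterSymmetric.holProjCurv D A X Y Z
        = (4 / (n + 2) : ℝ) • QuarterSymmetric.tensorH0 D1 A X Y Z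
          + ((n - 2) / (n + 2) : ℝ) • QuarterSymmetric.tensorH4 D1 A X Y Z ∧
    QuarterSymmetric.holProjCurv D A X Y Z
        = (4 * (n - 1) / (n + 2) : ℝ) • QuarterSymmetric.tensorH0 D1 A X Y Z
          - (2 * (n - 2) / (n + 2) : ℝ) • QuarterSymmetric.tensorH1 D1 A X Y Z
          - ((n - 2) / (n + 2) : ℝ) • QuarterSymmetric.tensorH2 D1 A X Y Z ∧
    QuarterSymmetric.holProjCurv D A X Y Z
        = (4 / (n + 2) : ℝ) • QuarterSymmetric.tensorH0 D1 A X Y Z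
          + ((n - 2) / (n + 2) : ℝ) •
            ((2 : ℝ) • QuarterSymmetric.tensorH5 D1 A X Z Y
              - QuarterSymmetric.tensorH1 D1 A X Z Y
              + QuarterSymmetric.tensorH1 D1 A Z Y X) := by
  subst hD1
  have : Nontrivial E := Module.nontrivial_of_finrank_pos (R := ℝ) (by omega)
  simp only [funext_iff, ← forall_and]
  intro x
  have sX : SmoothNear X x := Filter.Eventually.of_forall fun y ↦ hX y
  have sY : SmoothNear Y x := Filter.Eventually.of_forall fun y ↦ hY y
  have sZ : SmoothNear Z x := Filter.Eventually.of_forall fun y ↦ hZ y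
  have sAX := sX.act hA.smooth
  have sAY := sY.act hA.smooth
  have sAZ := sZ.act hA.smooth
  obtain ⟨R, hR⟩ := exists_curvature_tensor hD x
  obtain ⟨β, hβ⟩ := exists_form_derivative hη D x
  have hK := isKahlerCurvature_curvature hD hA hR
  have hC := fun X Y Z hX hY hZ ↦ curv_quarterSymmetric (X := X) (Y := Y) (Z := Z)
    hD hA hη hβ hR hX hY hZ
  have c0 := fun X Y Z hX hY hZ ↦ (hC X Y Z hX hY hZ).1
  have c1 := fun X Y Z hX hY hZ ↦ (hC X Y Z hX hY hZ).2.1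
  have c2 := fun X Y Z hX hY hZ ↦ (hC X Y Z hX hY hZ).2.2.1
  have c3 := fun X Y Z hX hY hZ ↦ (hC X Y Z hX hY hZ).2.2.2.1
  have c4 := fun X Y Z hX hY hZ ↦ (hC X Y Z hX hY hZ).2.2.2.2.1
  have c5 := fun X Y Z hX hY hZ ↦ (hC X Y Z hX hY hZ).2.2.2.2.2
  have r := ricci_eq_of_exists (r := fun y z ↦ ricciForm R y z) hR
    fun y z ↦ ⟨(R.flip y).flip z, fun v ↦ rfl, rfl⟩
  have r0 := ricci_eq_of_exists c0 (hK.trace_tensor0 β (η x))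
  have r1 := ricci_eq_of_exists c1 (hK.trace_tensor1 β)
  have r2 := ricci_eq_of_exists c2 (hK.trace_tensor2 β (η x))
  have r3 := ricci_eq_of_exists c3 (hK.trace_tensor3 β (η x))
  have r4 := ricci_eq_of_exists c4 (hK.trace_tensor4 β (η x))
  have r5 := ricci_eq_of_exists c5 (hK.trace_tensor5 β (η x))
  have r3' := ricci'_eq_of_exists c3 (hK.trace'_tensor3 β (η x))
  have r4' := ricci'_eq_of_exists c4 (hK.trace'_tensor4 β (η x))
  have hdim' : finrank ℝ (TangentSpace I x) = n := hdim
  have hsq (v : TangentSpace I x) : A x (A x v) = -v := hA.sq_eq_neg x v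
  have hsymm := hK.ricci_symm
  have hmap (y z : TangentSpace I x) : ricciForm R y (A x z) = -ricciForm R (A x y) z :=
    hK.ricci_map_right y z
  have hmap' (y z : TangentSpace I x) : ricciForm R (A x y) z = -ricciForm R (A x z) y := by
    rw [hsymm, hmap]
  have hbianchi : R (Z x) (Y x) (X x) = R (X x) (Y x) (Z x) - R (X x) (Z x) (Y x) := by
    rw [hK.swap (Z x), hK.swap (X x) (Z x), neg_eq_iff_add_eq_zero, ← hK.bianchi (X x) (Y x) (Z x)]
    abel
  have n1 : (n : ℝ) - 1 ≠ 0 := by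
    have : (4 : ℝ) ≤ n := by exact_mod_cast hn
    linarith
  have n2 : (n : ℝ) + 2 ≠ 0 := by positivity
  simp only [holProjCurv, tensorH0, tensorH1, tensorH2, tensorH4, tensorH5, Pi.add_apply,
    Pi.sub_apply, Pi.smul_apply, Pi.smul_apply', hdim,
    hR X Y Z sX sY sZ, c0 X Y Z sX sY sZ, c1 X Y Z sX sY sZ, c2 X Y Z sX sY sZ,
    c4 X Y Z sX sY sZ, c5 X Z Y sX sZ sY, c1 X Z Y sX sZ sY, c1 Z Y X sZ sY sX,
    r _ _ sX sZ, r _ _ sY sZ, r _ _ sX sAZ, r _ _ sY sAZ, r _ _ sX sAY,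
    r0 _ _ sX sZ, r0 _ _ sY sZ, r1 _ _ sX sZ, r1 _ _ sY sZ, r1 _ _ sY sAX, r1 _ _ sZ sAX,
    r1 _ _ sZ sY, r1 _ _ sY sAZ, r2 _ _ sAX sZ, r2 _ _ sAY sZ,
    r3 _ _ sZ sX, r3 _ _ sZ sY, r3 _ _ sZ sAX, r3 _ _ sZ sAY, r3 _ _ sY sAZ,
    r3' _ _ sAZ sAX, r3' _ _ sAZ sAY, r3' _ _ sAZ sX, r3' _ _ sAZ sY, r3' _ _ sAY sAZ,
    r3' _ _ sAY sX, r4 _ _ sX sZ, r4 _ _ sY sZ, r4' _ _ sAY sX, r4' _ _ sAZ sY,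
    r4' _ _ sAX sAZ, r4' _ _ sAY sAZ, r5 _ _ sX sZ, r5 _ _ sZ sY]
  simp only [act, tensor0, tensor1, tensor2, tensor4, tensor5]
  simp only [ContinuousLinearMap.coe_coe, hsq, hmap, map_neg, LinearMap.neg_apply, hdim', hbianchi,
    hsymm (Z x) (X x), hsymm (Z x) (Y x), hmap' (Z x) (X x), hmap' (Z x) (Y x),
    hmap' (Y x) (X x)]
  refine ⟨?_, ?_, ?_⟩ <;>
  · match_scalars <;> field_simp <;> ring
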